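/- Let $L^2_a$ be the Bergman space of the open unit disk $\mathbb{D}$, i.e. the space of all analytic functions $f:\mathbb{D}\to\mathbb{C}$ that are square-integrable with respect to area measure, with the $L^2$ norm. Let $0<r<1$ and $\varphi(z)=rz+1-r$, a hyperbolic non-automorphic self-map of $\mathbb{D}$. Then the composition operator $C_\varphi f=f\circ\varphi$ is a well-defined bounded linear operator on $L^2_a$, and its set of extended eigenvalues $$\mathrm{Ext}(C_\varphi)=\{\lambda\in\mathbb{C}:\ C_\varphi X=\lambda XC_\varphi\text{ for some nonzero bounded linear operator }X\text{ on }L^2_a\}$$ is the closed unit disk minus the origin: $$\mathrm{Ext}(C_\varphi)=\overline{\mathbb{D}}\setminus\{0\}.$$ -/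

import Mathlib

open MeasureTheory

noncomputable section

/-- Lebesgue area measure on the open unit disk of the complex plane. -/
def diskMeasure : Measure ℂ := volume.restrict (Metric.ball (0 : ℂ) 1)

/-- The function `g` is an analytic representative, on the open unit disk, of the `L²` class `f`.
Values of `g` outside the disk are irrelevant. -/
def IsAnalyticRep (f : Lp ℂ 2 diskMeasure) (g : ℂ → ℂ) : Prop :=
  DifferentiableOn ℂ g (Metric.ball (0 : ℂ) 1) ∧ f =ᵐ[diskMeasure] g

/-- The Bergman space `L²_a` of the unit disk: the subspace of `L²` of the disk consisting of the
(classes of) square-integrable analytic functions, with the norm and inner product of `L²`. -/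
def bergmanSpace : Submodule ℂ (Lp ℂ 2 diskMeasure) where
  carrier := {f | ∃ g : ℂ → ℂ, IsAnalyticRep f g}
  zero_mem' := ⟨0, differentiableOn_const 0, Lp.coeFn_zero _ _ _⟩
  add_mem' := by
    rintro f₁ f₂ ⟨g₁, hd₁, h₁⟩ ⟨g₂, hd₂, h₂⟩
    exact ⟨g₁ + g₂, hd₁.add hd₂, (Lp.coeFn_add f₁ f₂).trans (h₁.add h₂)⟩
  smul_mem' := by
    rintro c f ⟨g, hd, h⟩
    exact ⟨c • g, hd.const_smul c, (Lp.coeFn_smul c f).trans (h.const_smul c)⟩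

/-- The bounded operator `C` on the Bergman space is the composition operator `f ↦ f ∘ φ`
(with `f` read as an analytic function on the disk). -/
def IsCompositionOperator (φ : ℂ → ℂ) (C : bergmanSpace →L[ℂ] bergmanSpace) : Prop :=
  ∀ (f : bergmanSpace) (g : ℂ → ℂ),
    IsAnalyticRep (f : Lp ℂ 2 diskMeasure) g →
      IsAnalyticRep (C f : Lp ℂ 2 diskMeasure) (g ∘ φ)

/-- The extended spectrum `Ext(A)`: all complex `μ` such that `A X = μ X A` for some nonzero
bounded operator `X`. -/
def extendedSpectrum {H : Type*} [NormedAddCommGroup H] [InnerProductSpace ℂ H]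
    (A : H →L[ℂ] H) : Set ℂ :=
  {μ | ∃ X : H →L[ℂ] H, X ≠ 0 ∧ A ∘L X = μ • (X ∘L A)}

end

open Metric Set Filter Topology
open scoped ENNReal NNReal

/-! Everything rests on the identity `1 - φ z = r * (1 - z)`: on the disk, `(1 - z) ^ s` composed
with `φ` is `r ^ s` times itself.

If `0 ≤ re s`, the power is bounded, so multiplication by it is a bounded operator that intertwines
`C` with `r ^ s • C`. Taking `s = log μ / log r` reaches every `μ` with `0 < ‖μ‖ ≤ 1`
(`IsCompositionOperator.exp_mem_extendedSpectrum`).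

Conversely, `μ = 0` is excluded because `C` is injective. Let `1 < ‖μ‖` and `C X = μ X C`. For `-1 <
re s` the power lies in the Bergman space and is an eigenvector, so `X` sends it to zero or to an
eigenvector with eigenvalue `μ * r ^ s`. Since `‖C‖ ≤ r⁻¹`, the latter is impossible when `1 < ‖μ‖ *
r ^ (re s + 1)`, which holds for `re s` close to `-1`. Hence `X` kills the powers with exponents in
a nonempty open set. These span a dense subspace (`coe_mem_closure_span_bergmanPow`): pairing the
powers with a fixed `L²` function is holomorphic in `s`, so orthogonality on an open set spreads to
all exponents, including the naturals, and polynomials are dense. Thus `X = 0`. -/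

lemma diskMeasure_eq : diskMeasure = volume.restrict (ball (0 : ℂ) 1) := rfl

instance : IsFiniteMeasure diskMeasure :=
  isFiniteMeasure_restrict.2 measure_ball_lt_top.ne

lemma ae_mem_disk : ∀ᵐ z ∂diskMeasure, z ∈ ball (0 : ℂ) 1 :=
  ae_restrict_mem measurableSet_ball

lemma aestronglyMeasurable_disk {g : ℂ → ℂ} (hg : ContinuousOn g (ball (0 : ℂ) 1)) :
    AEStronglyMeasurable g diskMeasure :=
  hg.aestronglyMeasurable measurableSet_ball

lemma ae_eq_disk_of_eqOn {f g : ℂ → ℂ} (h : EqOn f g (ball (0 : ℂ) 1)) : f =ᵐ[diskMeasure] g :=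
  ae_mem_disk.mono fun _ hz => h hz

/-! ### Affine changes of variable in `L²`. -/

/-- The `L²` norm of the composition with an affine contraction of the plane. -/
lemma eLpNorm_comp_affine (u : ℂ → ℂ) {r : ℝ} (hr : 0 < r) (b : ℂ) :
    eLpNorm (fun z => u ((r : ℂ) * z + b)) 2 volume
      = ENNReal.ofReal r⁻¹ * eLpNorm u 2 volume := by
  have h1 : eLpNorm (fun z => u ((r : ℂ) * z + b)) 2 volume
      = eLpNorm ((fun y => u (y + b)) ∘ fun z : ℂ => r • z) 2 volume := by
    congr 1
  have hemb : MeasurableEmbedding fun z : ℂ => r • z :=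
    (Homeomorph.smulOfNeZero r hr.ne').measurableEmbedding
  rw [h1, ← hemb.eLpNorm_map_measure, Measure.map_addHaar_smul volume hr.ne',
    eLpNorm_smul_measure_of_ne_top (by simp)]
  have h2 : eLpNorm (fun y => u (y + b)) 2 volume = eLpNorm u 2 volume := by
    have := (measurableEmbedding_addRight b).eLpNorm_map_measure (μ := volume) (p := 2) (g := u)
    rw [map_add_right_eq_self] at this
    exact this.symm
  -- The plane has real dimension 2, so the Jacobian factor is `r⁻²`; the `L²` norm takes its square
  -- root.
  rw [h2, Complex.finrank_real_complex, smul_eq_mul, abs_of_pos (by positivity),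
    ENNReal.ofReal_rpow_of_pos (by positivity)]
  congr 2
  have : (1 / (2 : ℝ≥0∞)).toReal = 1 / 2 := by simp
  rw [this, ← Real.sqrt_eq_rpow, ← inv_pow, Real.sqrt_sq (by positivity)]

/-- Composition with an affine self-map of the disk is bounded in the `L²` norm of the disk. -/
lemma eLpNorm_comp_affine_disk_le (u : ℂ → ℂ) {r : ℝ} (hr : 0 < r) {b : ℂ}
    (hb : MapsTo (fun z => (r : ℂ) * z + b) (ball 0 1) (ball 0 1)) :
    eLpNorm (fun z => u ((r : ℂ) * z + b)) 2 diskMeasure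
      ≤ ENNReal.ofReal r⁻¹ * eLpNorm u 2 diskMeasure := by
  calc eLpNorm (fun z => u ((r : ℂ) * z + b)) 2 diskMeasure
      = eLpNorm (fun z => (ball (0 : ℂ) 1).indicator u ((r : ℂ) * z + b)) 2 diskMeasure := by
        refine eLpNorm_congr_ae (ae_eq_disk_of_eqOn fun z hz => ?_)
        exact (indicator_of_mem (hb hz) u).symm
    _ ≤ eLpNorm (fun z => (ball (0 : ℂ) 1).indicator u ((r : ℂ) * z + b)) 2 volume :=
        eLpNorm_mono_measure _ Measure.restrict_le_self
    _ = _ := by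
        rw [eLpNorm_comp_affine _ hr, eLpNorm_indicator_eq_eLpNorm_restrict measurableSet_ball,
          diskMeasure_eq]

/-! ### Analytic representatives and the operators they induce. -/

lemma IsAnalyticRep.memLp {f : Lp ℂ 2 diskMeasure} {g : ℂ → ℂ} (h : IsAnalyticRep f g) :
    MemLp g 2 diskMeasure :=
  (memLp_congr_ae h.2).1 (Lp.memLp f)

lemma IsAnalyticRep.eLpNorm_eq {f : Lp ℂ 2 diskMeasure} {g : ℂ → ℂ} (h : IsAnalyticRep f g) :
    eLpNorm g 2 diskMeasure = ENNReal.ofReal ‖f‖ := by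
  rw [Lp.norm_def, ENNReal.ofReal_toReal (Lp.eLpNorm_ne_top f), eLpNorm_congr_ae h.2]

lemma IsAnalyticRep.eq_of_eqOn {f₁ f₂ : Lp ℂ 2 diskMeasure} {g₁ g₂ : ℂ → ℂ}
    (h₁ : IsAnalyticRep f₁ g₁) (h₂ : IsAnalyticRep f₂ g₂) (h : EqOn g₁ g₂ (ball 0 1)) :
    f₁ = f₂ :=
  Lp.ext (h₁.2.trans ((ae_eq_disk_of_eqOn h).trans h₂.2.symm))

lemma IsAnalyticRep.eqOn {f : Lp ℂ 2 diskMeasure} {g₁ g₂ : ℂ → ℂ}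
    (h₁ : IsAnalyticRep f g₁) (h₂ : IsAnalyticRep f g₂) : EqOn g₁ g₂ (ball 0 1) :=
  Measure.eqOn_open_of_ae_eq (μ := volume) (h₁.2.symm.trans h₂.2) isOpen_ball
    h₁.1.continuousOn h₂.1.continuousOn

lemma IsAnalyticRep.smul {f : Lp ℂ 2 diskMeasure} {g : ℂ → ℂ} (h : IsAnalyticRep f g) (c : ℂ) :
    IsAnalyticRep (c • f) (c • g) :=
  ⟨h.1.const_smul c, (Lp.coeFn_smul c f).trans (h.2.const_smul c)⟩

lemma IsAnalyticRep.add {f₁ f₂ : Lp ℂ 2 diskMeasure} {g₁ g₂ : ℂ → ℂ}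
    (h₁ : IsAnalyticRep f₁ g₁) (h₂ : IsAnalyticRep f₂ g₂) : IsAnalyticRep (f₁ + f₂) (g₁ + g₂) :=
  ⟨h₁.1.add h₂.1, (Lp.coeFn_add f₁ f₂).trans (h₁.2.add h₂.2)⟩

lemma isAnalyticRep_zero : IsAnalyticRep 0 0 := ⟨differentiableOn_const 0, Lp.coeFn_zero _ _ _⟩

lemma isAnalyticRep_toLp {g : ℂ → ℂ} (hd : DifferentiableOn ℂ g (ball 0 1))
    (hg : MemLp g 2 diskMeasure) : IsAnalyticRep (hg.toLp g) g := ⟨hd, hg.coeFn_toLp⟩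

/-- A linear map of functions which preserves analyticity on the disk and is bounded in the
`L²` norm on analytic functions induces a bounded operator on the Bergman space. -/
lemma exists_bergman_operator (A : (ℂ → ℂ) →ₗ[ℂ] (ℂ → ℂ)) (K : ℝ) (hK : 0 ≤ K)
    (hd : ∀ g, DifferentiableOn ℂ g (ball 0 1) → DifferentiableOn ℂ (A g) (ball 0 1))
    (hA : ∀ g, eLpNorm (A g) 2 diskMeasure ≤ ENNReal.ofReal K * eLpNorm g 2 diskMeasure) :
    ∃ T : bergmanSpace →L[ℂ] bergmanSpace, ∀ (f : bergmanSpace) (g : ℂ → ℂ),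
      IsAnalyticRep (f : Lp ℂ 2 diskMeasure) g →
        IsAnalyticRep (T f : Lp ℂ 2 diskMeasure) (A g) := by
  have hmem : ∀ g, DifferentiableOn ℂ g (ball 0 1) → MemLp g 2 diskMeasure →
      MemLp (A g) 2 diskMeasure := fun g hg hL =>
    ⟨aestronglyMeasurable_disk (hd g hg).continuousOn,
      (hA g).trans_lt (ENNReal.mul_lt_top ENNReal.ofReal_lt_top hL.2)⟩
  have hex : ∀ f : bergmanSpace, ∃ k : bergmanSpace, ∀ g,
      IsAnalyticRep (f : Lp ℂ 2 diskMeasure) g →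
        IsAnalyticRep (k : Lp ℂ 2 diskMeasure) (A g) := by
    rintro ⟨f, g₀, hg₀⟩
    have h0 := isAnalyticRep_toLp (hd _ hg₀.1) (hmem _ hg₀.1 hg₀.memLp)
    refine ⟨⟨_, _, h0⟩, fun g hg => ⟨hd _ hg.1, h0.2.trans ?_⟩⟩
    -- Independence of the representative: `A (g₀ - g)` has norm zero by the bound `hA`.
    have hsub : g₀ - g =ᵐ[diskMeasure] 0 := by
      filter_upwards [hg₀.2, hg.2] with z h1 h2
      simp [← h1, ← h2]
    have hz : eLpNorm (A g₀ - A g) 2 diskMeasure = 0 := by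
      rw [← map_sub]
      refine le_antisymm ((hA _).trans ?_) bot_le
      rw [eLpNorm_congr_ae hsub]
      simp
    have hm : AEStronglyMeasurable (A g₀ - A g) diskMeasure :=
      (hmem _ hg₀.1 hg₀.memLp).1.sub (hmem _ hg.1 hg.memLp).1
    filter_upwards [(eLpNorm_eq_zero_iff hm two_ne_zero).1 hz] with z hz
    exact sub_eq_zero.1 hz
  choose T hT using hex
  refine ⟨LinearMap.mkContinuous ⟨⟨T, ?_⟩, ?_⟩ K ?_, hT⟩
  · rintro f₁ f₂
    obtain ⟨g₁, h₁⟩ := f₁.2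
    obtain ⟨g₂, h₂⟩ := f₂.2
    refine Subtype.ext ((hT _ _ (h₁.add h₂)).eq_of_eqOn ((hT _ _ h₁).add (hT _ _ h₂)) ?_)
    rw [map_add]
    exact eqOn_refl _ _
  · rintro c f
    obtain ⟨g, h⟩ := f.2
    refine Subtype.ext ((hT _ _ (h.smul c)).eq_of_eqOn ((hT _ _ h).smul c) ?_)
    rw [map_smul]
    exact eqOn_refl _ _
  · intro f
    obtain ⟨g, h⟩ := f.2
    have := hA g
    rw [h.eLpNorm_eq, (hT _ _ h).eLpNorm_eq, ← ENNReal.ofReal_mul hK] at this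
    exact (ENNReal.ofReal_le_ofReal_iff (by positivity)).1 this

/-! ### The composition operator: existence, norm bound, injectivity. -/

lemma mapsTo_disk_affine {r : ℝ} (hr0 : 0 < r) (hr1 : r < 1) :
    MapsTo (fun z : ℂ => (r : ℂ) * z + (1 - (r : ℂ))) (ball 0 1) (ball 0 1) := by
  intro z hz
  rw [mem_ball_zero_iff] at hz ⊢
  calc ‖(r : ℂ) * z + (1 - (r : ℂ))‖ ≤ ‖(r : ℂ) * z‖ + ‖((1 - r : ℝ) : ℂ)‖ := by
        push_cast; exact norm_add_le _ _
    _ = r * ‖z‖ + (1 - r) := by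
        rw [norm_mul, Complex.norm_real, Complex.norm_real, Real.norm_of_nonneg hr0.le,
          Real.norm_of_nonneg (by linarith)]
    _ < 1 := by nlinarith

lemma exists_isCompositionOperator {r : ℝ} (hr0 : 0 < r) (hr1 : r < 1) :
    ∃ C : bergmanSpace →L[ℂ] bergmanSpace,
      IsCompositionOperator (fun z : ℂ => (r : ℂ) * z + 1 - (r : ℂ)) C := by
  refine exists_bergman_operator
    (LinearMap.funLeft ℂ ℂ fun z : ℂ => (r : ℂ) * z + 1 - (r : ℂ)) r⁻¹ (by positivity) ?_ ?_
  · intro g hg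
    refine hg.comp (Differentiable.differentiableOn (by fun_prop)) ?_
    simpa only [add_sub_assoc] using mapsTo_disk_affine hr0 hr1
  · intro g
    have := eLpNorm_comp_affine_disk_le g hr0 (mapsTo_disk_affine hr0 hr1)
    simp only [← add_sub_assoc] at this
    exact this

section CompositionOperator

variable {r : ℝ} {C : bergmanSpace →L[ℂ] bergmanSpace}

/-- The exact constant `r⁻¹` matters: it equals `r ^ t` at `t = -1`, the edge of the range of
exponents for which the powers are square-integrable. -/
lemma IsCompositionOperator.norm_apply_le (hr0 : 0 < r) (hr1 : r < 1)
    (hC : IsCompositionOperator (fun z : ℂ => (r : ℂ) * z + 1 - (r : ℂ)) C) (f : bergmanSpace) :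
    ‖C f‖ ≤ r⁻¹ * ‖f‖ := by
  obtain ⟨g, h⟩ := f.2
  have := eLpNorm_comp_affine_disk_le g hr0 (mapsTo_disk_affine hr0 hr1)
  simp only [← add_sub_assoc] at this
  have h2 := (hC f g h).eLpNorm_eq
  rw [show (fun z : ℂ => g ((r : ℂ) * z + 1 - (r : ℂ)))
    = g ∘ (fun z : ℂ => (r : ℂ) * z + 1 - (r : ℂ)) from rfl, h2, h.eLpNorm_eq,
    ← ENNReal.ofReal_mul (by positivity)] at this
  exact (ENNReal.ofReal_le_ofReal_iff (by positivity)).1 this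

lemma IsCompositionOperator.eq_zero_of_apply_eq_zero (hr0 : 0 < r) (hr1 : r < 1)
    (hC : IsCompositionOperator (fun z : ℂ => (r : ℂ) * z + 1 - (r : ℂ)) C) {f : bergmanSpace}
    (hf : C f = 0) : f = 0 := by
  obtain ⟨g, h⟩ := f.2
  have h1 := hC f g h
  rw [hf] at h1
  have h2 := h1.eqOn isAnalyticRep_zero
  have hmaps : MapsTo (fun z : ℂ => (r : ℂ) * z + (1 - (r : ℂ))) (ball 0 1) (ball 0 1) :=
    mapsTo_disk_affine hr0 hr1
  have hr : (r : ℂ) ≠ 0 := by exact_mod_cast hr0.ne'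
  have hz₀ : (1 - (r : ℂ)) ∈ ball (0 : ℂ) 1 := by
    simpa using hmaps (mem_ball_self one_pos)
  have han : AnalyticOnNhd ℂ g (ball 0 1) := h.1.analyticOnNhd isOpen_ball
  -- The image of the disk under `φ` is a neighbourhood of `φ 0 = 1 - r`, so the identity theorem
  -- applies there.
  have hev : g =ᶠ[𝓝 (1 - (r : ℂ))] 0 := by
    have hcont : ContinuousAt (fun w : ℂ => (w - (1 - (r : ℂ))) / r) (1 - (r : ℂ)) := by fun_prop
    have hmem : ∀ᶠ w in 𝓝 (1 - (r : ℂ)), (w - (1 - (r : ℂ))) / r ∈ ball (0 : ℂ) 1 :=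
      hcont.eventually_mem (by simpa using ball_mem_nhds (0 : ℂ) one_pos)
    filter_upwards [hmem] with w hw
    have := h2 hw
    simp only [Function.comp_apply] at this
    rwa [mul_div_cancel₀ _ hr, show w - (1 - (r : ℂ)) + 1 - r = w by ring] at this
  have := han.eqOn_zero_of_preconnected_of_eventuallyEq_zero
    (convex_ball (0 : ℂ) 1).isPreconnected hz₀ hev
  exact Subtype.ext (h.eq_of_eqOn isAnalyticRep_zero this)

end CompositionOperator

/-! ### Powers of `1 - z` as eigenvectors and as multipliers. -/

/-- The power `(1 - z) ^ s`, with the principal branch. -/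
noncomputable def oneSubPow (s z : ℂ) : ℂ := Complex.exp (s * Complex.log (1 - z))

lemma one_sub_re_pos {z : ℂ} (hz : z ∈ ball (0 : ℂ) 1) : 0 < (1 - z).re := by
  have := (Complex.abs_re_le_norm z).trans_lt (mem_ball_zero_iff.1 hz)
  rw [Complex.sub_re, Complex.one_re]
  linarith [le_abs_self z.re]

lemma one_sub_ne_zero {z : ℂ} (hz : z ∈ ball (0 : ℂ) 1) : 1 - z ≠ 0 := by
  intro h
  have := one_sub_re_pos hz
  simp [h] at this

lemma one_sub_norm_lt {z : ℂ} (hz : z ∈ ball (0 : ℂ) 1) : ‖1 - z‖ < 2 := by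
  have := norm_sub_le 1 z
  rw [norm_one] at this
  linarith [mem_ball_zero_iff.1 hz]

lemma differentiableOn_oneSubPow (s : ℂ) : DifferentiableOn ℂ (oneSubPow s) (ball 0 1) := by
  intro z hz
  have h : (1 - z) ∈ Complex.slitPlane := Or.inl (one_sub_re_pos hz)
  have : DifferentiableAt ℂ (fun z : ℂ => Complex.log (1 - z)) z :=
    (differentiableAt_id.const_sub 1).clog h
  exact ((this.const_mul s).cexp).differentiableWithinAt

lemma oneSubPow_ne_zero (s z : ℂ) : oneSubPow s z ≠ 0 := Complex.exp_ne_zero _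

lemma oneSubPow_natCast (n : ℕ) {z : ℂ} (hz : z ∈ ball (0 : ℂ) 1) :
    oneSubPow n z = (1 - z) ^ n := by
  rw [oneSubPow, Complex.exp_nat_mul, Complex.exp_log (one_sub_ne_zero hz)]

lemma oneSubPow_affine {r : ℝ} (hr : 0 < r) (s : ℂ) {z : ℂ} (hz : z ∈ ball (0 : ℂ) 1) :
    oneSubPow s ((r : ℂ) * z + 1 - (r : ℂ))
      = Complex.exp (s * (Real.log r : ℝ)) * oneSubPow s z := by
  rw [oneSubPow, show 1 - ((r : ℂ) * z + 1 - (r : ℂ)) = r * (1 - z) by ring,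
    Complex.log_ofReal_mul hr (one_sub_ne_zero hz), mul_add, Complex.exp_add, oneSubPow]

lemma norm_oneSubPow_le (s : ℂ) {z : ℂ} (hz : z ∈ ball (0 : ℂ) 1) :
    ‖oneSubPow s z‖ ≤ Real.exp (Real.pi * |s.im|) * ‖1 - z‖ ^ s.re := by
  have h0 : 0 < ‖1 - z‖ := norm_pos_iff.2 (one_sub_ne_zero hz)
  rw [oneSubPow, Complex.norm_exp, Complex.mul_re, Complex.log_re, Complex.log_im,
    Real.rpow_def_of_pos h0, ← Real.exp_add]
  refine Real.exp_le_exp.2 ?_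
  have h1 : |s.im * (1 - z).arg| ≤ |s.im| * Real.pi := by
    rw [abs_mul]
    exact mul_le_mul_of_nonneg_left (Complex.abs_arg_le_pi _) (abs_nonneg _)
  nlinarith [neg_abs_le (s.im * (1 - z).arg)]

/-- Locally uniform domination of the powers by a single real power. -/
lemma norm_oneSubPow_le_of_re_mem {s : ℂ} {a b c : ℝ} (ha : a ≤ s.re) (hb : s.re ≤ b)
    (hc : |s.im| ≤ c) {z : ℂ} (hz : z ∈ ball (0 : ℂ) 1) :
    ‖oneSubPow s z‖ ≤ Real.exp (Real.pi * c) * (2 : ℝ) ^ (b - a) * ‖1 - z‖ ^ a := by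
  have h0 : 0 < ‖1 - z‖ := norm_pos_iff.2 (one_sub_ne_zero hz)
  refine (norm_oneSubPow_le s hz).trans ?_
  rw [mul_assoc]
  refine mul_le_mul (Real.exp_le_exp.2 (by gcongr)) ?_ (by positivity) (by positivity)
  calc ‖1 - z‖ ^ s.re = ‖1 - z‖ ^ (s.re - a) * ‖1 - z‖ ^ a := by
        rw [← Real.rpow_add h0, sub_add_cancel]
    _ ≤ 2 ^ (s.re - a) * ‖1 - z‖ ^ a := by
        refine mul_le_mul_of_nonneg_right ?_ (by positivity)
        exact Real.rpow_le_rpow h0.le (one_sub_norm_lt hz).le (by linarith)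
    _ ≤ 2 ^ (b - a) * ‖1 - z‖ ^ a := by
        gcongr
        exact one_le_two

/-- In real dimension 2 the singularity `‖w‖ ^ (2 * a)` is integrable at the origin when `-2 < 2 *
a`; the reflection `w = 1 - z` moves it to the boundary point 1. -/
lemma memLp_norm_one_sub_rpow {a : ℝ} (ha : -1 < a) :
    MemLp (fun z : ℂ => ‖1 - z‖ ^ a) 2 diskMeasure := by
  have hmeas : Measurable fun z : ℂ => ‖1 - z‖ ^ a := by fun_prop
  rw [memLp_two_iff_integrable_sq hmeas.aestronglyMeasurable]
  have hm : Measurable fun z : ℂ => ‖z‖ ^ (2 * a) := by fun_prop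
  have h1 : IntegrableOn (fun z : ℂ => ‖z‖ ^ (2 * a)) (ball 0 2) volume := by
    refine integrableOn_ball_of_norm_le_rpow (C := 1) (α := -(2 * a))
      (by rw [Complex.finrank_real_complex]; norm_num) ?_ ?_ hm.aestronglyMeasurable
    · rw [Complex.finrank_real_complex]
      push_cast
      linarith
    · refine Eventually.of_forall fun z => ?_
      rw [neg_neg, one_mul, Real.norm_of_nonneg (by positivity)]
  have h2 : IntegrableOn (fun z : ℂ => ‖1 - z‖ ^ (2 * a)) ((fun z => 1 - z) ⁻¹' ball (0 : ℂ) 2)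
      volume :=
    ((Measure.measurePreserving_sub_left volume (1 : ℂ)).integrableOn_comp_preimage
      (MeasurableEquiv.subLeft (1 : ℂ)).measurableEmbedding).2 h1
  have h3 : IntegrableOn (fun z : ℂ => ‖1 - z‖ ^ (2 * a)) (ball (0 : ℂ) 1) volume :=
    h2.mono_set fun z hz => mem_ball_zero_iff.2 (one_sub_norm_lt hz)
  refine Integrable.congr h3 (Eventually.of_forall fun z => ?_)
  simp only
  rw [mul_comm, Real.rpow_mul (norm_nonneg _), Real.rpow_two]

lemma memLp_oneSubPow {s : ℂ} (hs : -1 < s.re) : MemLp (oneSubPow s) 2 diskMeasure :=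
  (memLp_norm_one_sub_rpow hs).of_le_mul
    (aestronglyMeasurable_disk (differentiableOn_oneSubPow s).continuousOn)
    (ae_mem_disk.mono fun z hz => by
      rw [Real.norm_of_nonneg (by positivity : (0 : ℝ) ≤ ‖1 - z‖ ^ s.re)]
      exact norm_oneSubPow_le s hz)

/-- The powers `(1 - z) ^ s` with `-1 < re s`, as elements of the Bergman space. -/
noncomputable def bergmanPow (s : ℂ) (hs : -1 < s.re) : bergmanSpace :=
  ⟨(memLp_oneSubPow hs).toLp, _,
    isAnalyticRep_toLp (differentiableOn_oneSubPow s) (memLp_oneSubPow hs)⟩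

lemma isAnalyticRep_bergmanPow (s : ℂ) (hs : -1 < s.re) :
    IsAnalyticRep (bergmanPow s hs : Lp ℂ 2 diskMeasure) (oneSubPow s) :=
  isAnalyticRep_toLp (differentiableOn_oneSubPow s) (memLp_oneSubPow hs)

lemma IsCompositionOperator.apply_bergmanPow {r : ℝ} {C : bergmanSpace →L[ℂ] bergmanSpace}
    (hr0 : 0 < r)
    (hC : IsCompositionOperator (fun z : ℂ => (r : ℂ) * z + 1 - (r : ℂ)) C)
    (s : ℂ) (hs : -1 < s.re) :
    C (bergmanPow s hs) = Complex.exp (s * (Real.log r : ℝ)) • bergmanPow s hs :=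
  Subtype.ext ((hC _ _ (isAnalyticRep_bergmanPow s hs)).eq_of_eqOn
    ((isAnalyticRep_bergmanPow s hs).smul _) fun _ hz => oneSubPow_affine hr0 s hz)

/-- The multiplication by a power with nonnegative real part of the exponent intertwines the
composition operator with its multiple. -/
lemma IsCompositionOperator.exp_mem_extendedSpectrum {r : ℝ}
    {C : bergmanSpace →L[ℂ] bergmanSpace} (hr0 : 0 < r)
    (hC : IsCompositionOperator (fun z : ℂ => (r : ℂ) * z + 1 - (r : ℂ)) C)
    {s : ℂ} (hs : 0 ≤ s.re) :
    Complex.exp (s * (Real.log r : ℝ)) ∈ extendedSpectrum C := by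
  obtain ⟨M, hM⟩ := exists_bergman_operator (LinearMap.mulLeft ℂ (oneSubPow s))
    (Real.exp (Real.pi * |s.im|) * (2 : ℝ) ^ (s.re - 0)) (by positivity)
    (fun g hg => (differentiableOn_oneSubPow s).mul hg) fun g => by
      refine eLpNorm_le_mul_eLpNorm_of_ae_le_mul (ae_mem_disk.mono fun z hz => ?_) 2
      rw [LinearMap.mulLeft_apply, Pi.mul_apply, norm_mul]
      gcongr
      simpa using norm_oneSubPow_le_of_re_mem hs le_rfl le_rfl hz
  refine ⟨M, fun h0 => ?_, ?_⟩
  · have h1 := hM _ _ (isAnalyticRep_bergmanPow 0 (by simp))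
    rw [h0] at h1
    have := h1.eqOn isAnalyticRep_zero (mem_ball_self one_pos)
    simp [oneSubPow_ne_zero] at this
  · refine ContinuousLinearMap.ext fun f => Subtype.ext ?_
    obtain ⟨g, h⟩ := f.2
    refine (hC _ _ (hM _ _ h)).eq_of_eqOn ((hM _ _ (hC _ _ h)).smul _) fun z hz => ?_
    simp only [Function.comp_apply, LinearMap.mulLeft_apply, Pi.mul_apply, Pi.smul_apply,
      smul_eq_mul, oneSubPow_affine hr0 s hz, mul_assoc]

/-! ### Holomorphic dependence on the exponent. -/

/-- An integral depending holomorphically on a parameter, with a locally uniform integrable bound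
of the integrand only, is holomorphic. -/
lemma differentiableOn_integral_of_norm_le {α : Type*} [MeasurableSpace α] {μ : Measure α}
    {F : ℂ → α → ℂ} {U : Set ℂ} (hU : IsOpen U)
    (hmeas : ∀ s ∈ U, AEStronglyMeasurable (F s) μ)
    (hdiff : ∀ᵐ x ∂μ, Differentiable ℂ fun s => F s x)
    (hbound : ∀ s ∈ U, ∃ δ > 0, ∃ B : α → ℝ, Integrable B μ ∧
      ∀ᵐ x ∂μ, ∀ t ∈ ball s δ, ‖F t x‖ ≤ B x) :
    DifferentiableOn ℂ (fun s => ∫ x, F s x ∂μ) U := by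
  intro s hs
  obtain ⟨δ, hδ, B, hB, hle⟩ := hbound s hs
  -- The derivative is measurable in `x` as an a.e. limit of difference quotients along a sequence,
  -- shifted by `N` to stay in `U`.
  have hF' : AEStronglyMeasurable (fun x => deriv (fun t => F t x) s) μ := by
    obtain ⟨u, -, hu, hlim⟩ := exists_seq_strictAnti_tendsto' (x := (0 : ℝ)) (y := 1) one_pos
    have hs_tend : Tendsto (fun n => s + (u n : ℂ)) atTop (𝓝[≠] s) := by
      refine tendsto_nhdsWithin_iff.2 ⟨?_, Eventually.of_forall fun n => ?_⟩
      · have : Tendsto (fun n => s + (u n : ℂ)) atTop (𝓝 (s + ((0 : ℝ) : ℂ))) :=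
          tendsto_const_nhds.add ((Complex.continuous_ofReal.tendsto 0).comp hlim)
        simpa using this
      · simp [(hu n).1.ne']
    have hsU : ∀ᶠ n in atTop, s + (u n : ℂ) ∈ U :=
      (hs_tend.mono_right nhdsWithin_le_nhds).eventually_mem (hU.mem_nhds hs)
    obtain ⟨N, hN⟩ := eventually_atTop.1 hsU
    refine aestronglyMeasurable_of_tendsto_ae atTop
      (f := fun n x => slope (fun t => F t x) s (s + (u (n + N) : ℂ))) (fun n => ?_) ?_
    · simp only [slope_def_field]
      simp only [div_eq_mul_inv]
      exact ((hmeas _ (hN _ (Nat.le_add_left _ _))).sub (hmeas s hs)).mul_const _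
    · filter_upwards [hdiff] with x hx
      exact ((hasDerivAt_iff_tendsto_slope.1 (hx s).hasDerivAt).comp hs_tend).comp
        (tendsto_add_atTop_nat N)
  -- Since `1/2 + 1/3 < 1`, circles of radius `δ / 3` centred in `ball s (δ / 2)` stay in `ball s
  -- δ`; Cauchy's estimate then bounds the derivative by `B x / (δ / 3)`.
  have hball : ball s (δ / 2) ∈ 𝓝 s := ball_mem_nhds s (by positivity)
  refine (hasDerivAt_integral_of_dominated_loc_of_deriv_le (bound := fun x => B x / (δ / 3))
    (F' := fun t x => deriv (fun t => F t x) t) hball ?_ ?_ hF' ?_ (hB.div_const _)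
    ?_).2.differentiableAt.differentiableWithinAt
  · filter_upwards [hU.mem_nhds hs] with t ht using hmeas t ht
  · exact hB.mono' (hmeas s hs) (hle.mono fun x hx => hx s (mem_ball_self hδ))
  · filter_upwards [hdiff, hle] with x hx hx2 t ht
    refine Complex.norm_deriv_le_of_forall_mem_sphere_norm_le (by positivity)
      hx.diffContOnCl fun w hw => hx2 w ?_
    rw [mem_sphere] at hw
    rw [mem_ball] at ht ⊢
    linarith [dist_triangle w t s]
  · filter_upwards [hdiff] with x hx t _ using (hx t).hasDerivAt

lemma differentiableOn_integral_mul_oneSubPow {h : ℂ → ℂ} (hh : MemLp h 2 diskMeasure) :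
    DifferentiableOn ℂ (fun s => ∫ z, h z * oneSubPow s z ∂diskMeasure) {s | -1 < s.re} := by
  refine differentiableOn_integral_of_norm_le (isOpen_lt continuous_const Complex.continuous_re)
    (fun s hs => hh.1.mul (memLp_oneSubPow hs).1) (Eventually.of_forall fun z => ?_)
    fun s hs => ?_
  · simp only [oneSubPow]
    fun_prop
  · rw [mem_ofPred_eq] at hs
    -- Half the distance to the line `re = -1`, so that the dominating exponent `s.re - δ` is still
    -- above `-1`.
    set δ : ℝ := (s.re + 1) / 2 with hδ
    refine ⟨δ, by rw [hδ]; linarith, fun z => ‖h z‖ * (Real.exp (Real.pi * (|s.im| + δ)) *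
      (2 : ℝ) ^ ((s.re + δ) - (s.re - δ)) * ‖1 - z‖ ^ (s.re - δ)), ?_, ?_⟩
    · exact hh.norm.integrable_mul
        ((memLp_norm_one_sub_rpow (by rw [hδ]; linarith)).const_mul _)
    · filter_upwards [ae_mem_disk] with z hz t ht
      rw [norm_mul]
      rw [mem_ball, dist_eq_norm] at ht
      have h1 := abs_le.1 ((Complex.abs_re_le_norm (t - s)).trans ht.le)
      have h2 := (Complex.abs_im_le_norm (t - s)).trans ht.le
      rw [Complex.sub_re] at h1
      rw [Complex.sub_im] at h2
      gcongr
      refine norm_oneSubPow_le_of_re_mem (by linarith) (by linarith) ?_ hz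
      linarith [abs_sub_abs_le_abs_sub t.im s.im]

/-! ### Density: powers to polynomials, to functions analytic on a larger disk, to the whole space.
-/

lemma toLp_mem_of_approx {N : Submodule ℂ (Lp ℂ 2 diskMeasure)}
    (hN : IsClosed (N : Set (Lp ℂ 2 diskMeasure))) {g : ℂ → ℂ} (hg : MemLp g 2 diskMeasure)
    (H : ∀ ε : ℝ, 0 < ε → ∃ (k : ℂ → ℂ) (hk : MemLp k 2 diskMeasure), hk.toLp k ∈ N ∧
      eLpNorm (g - k) 2 diskMeasure ≤ ENNReal.ofReal ε) :
    hg.toLp g ∈ N := by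
  rw [← SetLike.mem_coe, ← hN.closure_eq, EMetric.mem_closure_iff]
  intro ε hε
  obtain ⟨ε', h0, h1⟩ := ENNReal.lt_iff_exists_real_btwn.1 hε
  obtain ⟨k, hk, hkN, hle⟩ := H ε' (ENNReal.ofReal_pos.1 h1.1)
  refine ⟨_, hkN, ?_⟩
  rw [Lp.edist_toLp_toLp]
  exact hle.trans_lt h1.2

lemma memLp_disk_of_norm_le {g : ℂ → ℂ} (hg : ContinuousOn g (ball 0 1)) {K : ℝ}
    (hK : ∀ z ∈ ball (0 : ℂ) 1, ‖g z‖ ≤ K) : MemLp g 2 diskMeasure :=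
  MemLp.of_bound (aestronglyMeasurable_disk hg) K (ae_mem_disk.mono hK)

lemma memLp_polynomial_eval (p : Polynomial ℂ) :
    MemLp (fun z => p.eval z) 2 diskMeasure := by
  obtain ⟨K, hK⟩ := (isCompact_closedBall (0 : ℂ) 1).exists_bound_of_continuousOn
    p.continuous.continuousOn
  exact memLp_disk_of_norm_le p.continuous.continuousOn fun z hz => hK z (ball_subset_closedBall hz)

lemma eLpNorm_disk_le_of_norm_le {u : ℂ → ℂ} {η : ℝ}
    (hu : ∀ z ∈ ball (0 : ℂ) 1, ‖u z‖ ≤ η) :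
    eLpNorm u 2 diskMeasure
      ≤ ENNReal.ofReal ((diskMeasure univ ^ (2 : ℝ≥0∞).toReal⁻¹).toReal * η) := by
  rw [ENNReal.ofReal_mul ENNReal.toReal_nonneg, ENNReal.ofReal_toReal
    (ENNReal.rpow_ne_top_of_nonneg (by positivity) (measure_ne_top _ _))]
  exact eLpNorm_le_of_ae_bound (ae_mem_disk.mono hu)

lemma exists_pos_eLpNorm_disk_le {ε : ℝ} (hε : 0 < ε) : ∃ η > 0, ∀ u : ℂ → ℂ,
    (∀ z ∈ ball (0 : ℂ) 1, ‖u z‖ ≤ η) → eLpNorm u 2 diskMeasure ≤ ENNReal.ofReal ε := by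
  set m := (diskMeasure univ ^ (2 : ℝ≥0∞).toReal⁻¹).toReal with hm
  have hm0 : 0 ≤ m := ENNReal.toReal_nonneg
  refine ⟨ε / (m + 1), by positivity, fun u hu => (eLpNorm_disk_le_of_norm_le hu).trans ?_⟩
  refine ENNReal.ofReal_le_ofReal ?_
  rw [← hm, ← mul_div_assoc, div_le_iff₀ (by positivity)]
  nlinarith

section Density

variable {N : Submodule ℂ (Lp ℂ 2 diskMeasure)}

lemma toLp_eval_one_sub_mem
    (hpow : ∀ s hs, (bergmanPow s hs : Lp ℂ 2 diskMeasure) ∈ N) (p : Polynomial ℂ)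
    (hp : MemLp (fun z => p.eval (1 - z)) 2 diskMeasure) : hp.toLp _ ∈ N := by
  have hmem : ∀ p : Polynomial ℂ, MemLp (fun z => p.eval (1 - z)) 2 diskMeasure := fun p => by
    convert memLp_polynomial_eval (p.comp (1 - Polynomial.X)) using 2 with z
    simp
  induction p using Polynomial.induction_on' with
  | add p q h1 h2 =>
    have h3 := N.add_mem (h1 (hmem p)) (h2 (hmem q))
    rw [← MemLp.toLp_add] at h3
    convert h3 using 2
    ext z
    simp
  | monomial n a =>
    have hn : (-1 : ℝ) < ((n : ℂ)).re := by
      rw [Complex.natCast_re]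
      linarith [n.cast_nonneg (α := ℝ)]
    have h3 := N.smul_mem a (hpow n hn)
    convert h3
    refine Lp.ext (hp.coeFn_toLp.trans ?_)
    refine EventuallyEq.trans ?_ (((isAnalyticRep_bergmanPow n hn).smul a).2).symm
    refine ae_eq_disk_of_eqOn fun z hz => ?_
    simp [oneSubPow_natCast n hz]

lemma toLp_eval_mem (hpow : ∀ s hs, (bergmanPow s hs : Lp ℂ 2 diskMeasure) ∈ N)
    (p : Polynomial ℂ) : (memLp_polynomial_eval p).toLp _ ∈ N := by
  have h : (fun z => p.eval z) = fun z => (p.comp (1 - Polynomial.X)).eval (1 - z) := by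
    ext z
    simp
  have h2 := memLp_polynomial_eval p
  rw [h] at h2
  convert toLp_eval_one_sub_mem hpow _ h2

lemma toLp_mem_of_differentiableOn_closedBall (hN : IsClosed (N : Set (Lp ℂ 2 diskMeasure)))
    (hpow : ∀ s hs, (bergmanPow s hs : Lp ℂ 2 diskMeasure) ∈ N) {g : ℂ → ℂ} {R : ℝ≥0}
    (hR : 1 < R) (hd : DifferentiableOn ℂ g (closedBall 0 R)) (hg : MemLp g 2 diskMeasure) :
    hg.toLp g ∈ N := by
  refine toLp_mem_of_approx hN hg fun ε hε => ?_
  obtain ⟨η, hη, hle⟩ := exists_pos_eLpNorm_disk_le hε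
  have hps := hd.hasFPowerSeriesOnBall (zero_lt_one.trans hR)
  have hu := hps.tendstoUniformlyOn (r' := 1) (by exact_mod_cast hR)
  rw [Metric.tendstoUniformlyOn_iff] at hu
  obtain ⟨n, hn⟩ := (hu η hη).exists
  set P := cauchyPowerSeries g 0 R
  refine ⟨_, _, toLp_eval_mem hpow (∑ k ∈ Finset.range n, Polynomial.monomial k (P.coeff k)),
    hle _ fun z hz => ?_⟩
  have := hn z (by simpa using hz)
  rw [dist_eq_norm, zero_add] at this
  refine le_of_eq_of_le ?_ this.le
  rw [Pi.sub_apply, FormalMultilinearSeries.partialSum, Polynomial.eval_finsetSum]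
  congr 2
  refine Finset.sum_congr rfl fun k _ => ?_
  rw [FormalMultilinearSeries.apply_eq_pow_smul_coeff, Polynomial.eval_monomial, smul_eq_mul,
    mul_comm]

/-- The dilations of a square-integrable function on the disk approximate it in `L²`. -/
lemma exists_eLpNorm_sub_dilation_le {g : ℂ → ℂ} (hg : MemLp g 2 diskMeasure) {ε : ℝ}
    (hε : 0 < ε) : ∃ ρ : ℝ, 0 < ρ ∧ ρ < 1 ∧
      eLpNorm (g - fun z => g (ρ * z)) 2 diskMeasure ≤ ENNReal.ofReal ε := by
  set G := (ball (0 : ℂ) 1).indicator g with hG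
  have hGL : MemLp G 2 volume := (memLp_indicator_iff_restrict measurableSet_ball).2 hg
  have hε4 : 0 < ε / 4 := by positivity
  obtain ⟨k, hkc, hk, hkcont, hkL⟩ := hGL.exists_hasCompactSupport_eLpNorm_sub_le (by simp)
    (ENNReal.ofReal_pos.2 hε4).ne'
  obtain ⟨η, hη, hle⟩ := exists_pos_eLpNorm_disk_le hε4
  obtain ⟨δ, hδ, hunif⟩ := Metric.uniformContinuous_iff.1
    (hkc.uniformContinuous_of_continuous hkcont) η hη
  -- `1 - ρ < δ` serves the uniform continuity of `k`; `1/2 < ρ` keeps the dilation factor `ρ⁻¹`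
  -- below 2, so the dilated error costs at most `ε / 2`.
  obtain ⟨ρ, hρ, hρ1⟩ := exists_between (max_lt (by norm_num : (1 / 2 : ℝ) < 1)
    (sub_lt_self 1 hδ))
  have hρ2 : 1 / 2 < ρ := (le_max_left _ _).trans_lt hρ
  have hρδ : 1 - ρ < δ := by linarith [(le_max_right (1 / 2) (1 - δ)).trans_lt hρ]
  have hρ0 : 0 < ρ := by linarith
  have hmaps : ∀ z ∈ ball (0 : ℂ) 1, (ρ : ℂ) * z ∈ ball (0 : ℂ) 1 := fun z hz => by
    rw [mem_ball_zero_iff] at hz ⊢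
    rw [norm_mul, Complex.norm_real, Real.norm_of_nonneg hρ0.le]
    nlinarith [norm_nonneg z]
  refine ⟨ρ, hρ0, hρ1, ?_⟩
  have hcongr : (g - fun z => g (ρ * z)) =ᵐ[diskMeasure]
      ((G - k) + (k - fun z => k (ρ * z))) - fun z => (G - k) (ρ * z) := by
    refine ae_eq_disk_of_eqOn fun z hz => ?_
    simp only [Pi.sub_apply, Pi.add_apply, hG, indicator_of_mem hz, indicator_of_mem (hmaps z hz)]
    ring
  have e3 : eLpNorm (fun z => (G - k) ((ρ : ℂ) * z)) 2 volume ≤ ENNReal.ofReal (ε / 2) := by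
    have := eLpNorm_comp_affine (G - k) hρ0 0
    simp only [add_zero] at this
    rw [this]
    calc ENNReal.ofReal ρ⁻¹ * eLpNorm (G - k) 2 volume
        ≤ ENNReal.ofReal 2 * ENNReal.ofReal (ε / 4) := by
          refine mul_le_mul' (ENNReal.ofReal_le_ofReal ?_) hk
          rw [inv_le_comm₀ hρ0 two_pos]
          linarith
      _ = ENNReal.ofReal (ε / 2) := by
          rw [← ENNReal.ofReal_mul two_pos.le]
          congr 1
          ring
  have e1 : eLpNorm (G - k) 2 diskMeasure ≤ ENNReal.ofReal (ε / 4) :=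
    (eLpNorm_mono_measure _ Measure.restrict_le_self).trans hk
  have e2 : eLpNorm (k - fun z => k (ρ * z)) 2 diskMeasure ≤ ENNReal.ofReal (ε / 4) := by
    refine hle _ fun z hz => ?_
    rw [Pi.sub_apply, ← dist_eq_norm]
    refine (hunif ?_).le
    rw [dist_eq_norm, show z - (ρ : ℂ) * z = ((1 - ρ : ℝ) : ℂ) * z by push_cast; ring, norm_mul,
      Complex.norm_real, Real.norm_of_nonneg (by linarith)]
    rw [mem_ball_zero_iff] at hz
    nlinarith [norm_nonneg z]
  have e3' : eLpNorm (fun z => (G - k) ((ρ : ℂ) * z)) 2 diskMeasure ≤ ENNReal.ofReal (ε / 2) :=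
    (eLpNorm_mono_measure _ Measure.restrict_le_self).trans e3
  have m1 : AEStronglyMeasurable (G - k) diskMeasure := (hGL.1.sub hkL.1).restrict
  have m2 : AEStronglyMeasurable (k - fun z => k (ρ * z)) diskMeasure :=
    (hkcont.sub (hkcont.comp (by fun_prop))).aestronglyMeasurable
  have m3 : AEStronglyMeasurable (fun z => (G - k) ((ρ : ℂ) * z)) diskMeasure := by
    refine AEStronglyMeasurable.restrict ?_
    refine (hGL.1.sub hkL.1).comp_quasiMeasurePreserving ⟨by fun_prop, ?_⟩
    have h := Measure.map_addHaar_smul (volume : Measure ℂ) hρ0.ne'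
    simp only [Complex.real_smul] at h
    rw [h]
    exact Measure.smul_absolutelyContinuous
  rw [eLpNorm_congr_ae hcongr]
  calc _ ≤ eLpNorm ((G - k) + (k - fun z => k (ρ * z))) 2 diskMeasure
        + eLpNorm (fun z => (G - k) ((ρ : ℂ) * z)) 2 diskMeasure :=
        eLpNorm_sub_le (m1.add m2) m3 one_le_two
    _ ≤ ENNReal.ofReal (ε / 4) + ENNReal.ofReal (ε / 4) + ENNReal.ofReal (ε / 2) :=
        add_le_add ((eLpNorm_add_le m1 m2 one_le_two).trans (add_le_add e1 e2)) e3'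
    _ = ENNReal.ofReal ε := by
        rw [← ENNReal.ofReal_add hε4.le hε4.le, ← ENNReal.ofReal_add (by positivity)
          (by positivity)]
        congr 1
        ring

lemma coe_mem_of_forall_bergmanPow_mem (hN : IsClosed (N : Set (Lp ℂ 2 diskMeasure)))
    (hpow : ∀ s hs, (bergmanPow s hs : Lp ℂ 2 diskMeasure) ∈ N) (f : bergmanSpace) :
    (f : Lp ℂ 2 diskMeasure) ∈ N := by
  obtain ⟨g, h⟩ := f.2
  have hf : (f : Lp ℂ 2 diskMeasure) = h.memLp.toLp g :=
    h.eq_of_eqOn (isAnalyticRep_toLp h.1 h.memLp) (eqOn_refl _ _)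
  rw [hf]
  refine toLp_mem_of_approx hN h.memLp fun ε hε => ?_
  obtain ⟨ρ, hρ0, hρ1, hle⟩ := exists_eLpNorm_sub_dilation_le h.memLp hε
  -- With `1 < R < ρ⁻¹`, the dilation is analytic on a disk strictly larger than the unit disk.
  obtain ⟨R, hR1, hR⟩ := exists_between ((one_lt_inv₀ hρ0).2 hρ1)
  lift R to ℝ≥0 using by linarith
  have hd : DifferentiableOn ℂ (fun z => g (ρ * z)) (closedBall 0 R) := by
    refine h.1.comp (Differentiable.differentiableOn (by fun_prop)) fun z hz => ?_
    rw [mem_closedBall_zero_iff] at hz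
    rw [mem_ball_zero_iff, norm_mul, Complex.norm_real, Real.norm_of_nonneg hρ0.le]
    calc ρ * ‖z‖ ≤ ρ * R := by gcongr
      _ < ρ * ρ⁻¹ := by gcongr
      _ = 1 := mul_inv_cancel₀ hρ0.ne'
  have hsub : ball (0 : ℂ) 1 ⊆ closedBall 0 R :=
    ball_subset_closedBall.trans (closedBall_subset_closedBall hR1.le)
  obtain ⟨K, hK⟩ := (isCompact_closedBall (0 : ℂ) R).exists_bound_of_continuousOn hd.continuousOn
  have hL : MemLp (fun z => g (ρ * z)) 2 diskMeasure :=
    memLp_disk_of_norm_le (hd.continuousOn.mono hsub) fun z hz => hK z (hsub hz)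
  exact ⟨_, hL, toLp_mem_of_differentiableOn_closedBall hN hpow (by exact_mod_cast hR1) hd hL, hle⟩

end Density

/-! ### Density of the powers with exponents in an open set. -/

/-- The powers with exponents in a nonempty open subset of the half-plane `-1 < re s` span a dense
subspace of the Bergman space. -/
lemma coe_mem_closure_span_bergmanPow {V : Set ℂ} (hV : IsOpen V) (hne : V.Nonempty)
    (hre : ∀ s ∈ V, -1 < s.re) (f : bergmanSpace) :
    (f : Lp ℂ 2 diskMeasure) ∈ (Submodule.span ℂ
      (range fun s : V => (bergmanPow s (hre s s.2) : Lp ℂ 2 diskMeasure))).topologicalClosure := by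
  refine coe_mem_of_forall_bergmanPow_mem (Submodule.isClosed_topologicalClosure _) ?_ f
  intro s hs
  rw [← Submodule.orthogonal_orthogonal_eq_closure, Submodule.mem_orthogonal']
  intro h hh
  -- The inner product is conjugate-linear in its first argument, so placing the power second makes
  -- the pairing holomorphic in `s`.
  have hint : ∀ s hs, inner ℂ h (bergmanPow s hs : Lp ℂ 2 diskMeasure)
      = ∫ z, star h z * oneSubPow s z ∂diskMeasure := by
    intro s hs
    rw [L2.inner_def]
    refine integral_congr_ae ?_
    filter_upwards [(isAnalyticRep_bergmanPow s hs).2, Lp.coeFn_star h] with z hz hz2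
    rw [hz, hz2, RCLike.inner_apply, mul_comm]
    rfl
  have han : AnalyticOnNhd ℂ (fun s => ∫ z, star h z * oneSubPow s z ∂diskMeasure)
      {s | -1 < s.re} :=
    (differentiableOn_integral_mul_oneSubPow (Lp.memLp (star h))).analyticOnNhd
      (isOpen_lt continuous_const Complex.continuous_re)
  obtain ⟨s₀, hs₀⟩ := hne
  have hz := han.eqOn_zero_of_preconnected_of_eventuallyEq_zero
    (convex_halfSpace_re_gt (-1)).isPreconnected (hre s₀ hs₀) (by
      filter_upwards [hV.mem_nhds hs₀] with t ht
      rw [← hint t (hre t ht)]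
      exact (Submodule.mem_orthogonal' _ _).1 hh _ (Submodule.subset_span ⟨⟨t, ht⟩, rfl⟩)) hs
  rw [← inner_conj_symm, hint s hs]
  exact (congrArg _ hz).trans (map_zero _)

lemma eq_zero_of_forall_bergmanPow {X : bergmanSpace →L[ℂ] bergmanSpace} {V : Set ℂ}
    (hV : IsOpen V) (hne : V.Nonempty) (hre : ∀ s ∈ V, -1 < s.re)
    (hX : ∀ s (hs : s ∈ V), X (bergmanPow s (hre s hs)) = 0) : X = 0 := by
  refine ContinuousLinearMap.ext fun f => ?_
  have hf := coe_mem_closure_span_bergmanPow hV hne hre f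
  have hle : Submodule.span ℂ (range fun s : V => bergmanPow s (hre s s.2))
      ≤ LinearMap.ker (X : bergmanSpace →ₗ[ℂ] bergmanSpace) := by
    rw [Submodule.span_le]
    rintro _ ⟨s, rfl⟩
    exact hX s s.2
  have hmap : Submodule.span ℂ (range fun s : V => (bergmanPow s (hre s s.2) : Lp ℂ 2 diskMeasure))
      = (Submodule.span ℂ (range fun s : V => bergmanPow s (hre s s.2))).map
        bergmanSpace.subtype := by
    rw [Submodule.map_span, ← range_comp]
    rfl
  -- Membership in the `L²` closure of the image of the span is turned into membership in its
  -- closure inside the Bergman space, where the kernel of `X` is closed.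
  rw [hmap, ← SetLike.mem_coe, Submodule.topologicalClosure_coe, Submodule.map_coe,
    Submodule.coe_subtype, ← closure_subtype] at hf
  exact closure_minimal hle X.isClosed_ker hf

/-! ### Exclusion of `1 < ‖μ‖`, and the conclusion. -/

lemma not_mem_extendedSpectrum_of_one_lt_norm {r : ℝ} {C : bergmanSpace →L[ℂ] bergmanSpace}
    (hr0 : 0 < r) (hr1 : r < 1)
    (hC : IsCompositionOperator (fun z : ℂ => (r : ℂ) * z + 1 - (r : ℂ)) C) {μ : ℂ}
    (hμ : 1 < ‖μ‖) : μ ∉ extendedSpectrum C := by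
  rintro ⟨X, hX0, hX⟩
  refine hX0 (eq_zero_of_forall_bergmanPow
    (V := {s : ℂ | -1 < s.re ∧ 1 < ‖μ‖ * r ^ (s.re + 1)}) ?_ ?_ (fun s hs => hs.1) ?_)
  · have hcont : Continuous fun s : ℂ => ‖μ‖ * r ^ (s.re + 1) :=
      continuous_const.mul (continuous_const.rpow (by fun_prop) fun _ => Or.inl hr0.ne')
    exact (isOpen_lt continuous_const Complex.continuous_re).and
      (isOpen_lt continuous_const hcont)
  -- At `t = -1` the expression equals `‖μ‖ > 1`, so the inequality persists slightly to the right.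
  · have hcont : ContinuousAt (fun t : ℝ => ‖μ‖ * r ^ (t + 1)) (-1) :=
      continuousAt_const.mul (continuousAt_const.rpow (by fun_prop) (Or.inl hr0.ne'))
    have hev : ∀ᶠ t in 𝓝[>] (-1 : ℝ), 1 < ‖μ‖ * r ^ (t + 1) :=
      (hcont.eventually (lt_mem_nhds (by simpa using hμ))).filter_mono nhdsWithin_le_nhds
    obtain ⟨t, h1, h2⟩ := (hev.and self_mem_nhdsWithin).exists
    exact ⟨t, by simpa using h2, by simpa using h1⟩
  · rintro s ⟨hs, hs2⟩
    have h1 := congrArg (fun T => T (bergmanPow s hs)) hX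
    simp only [ContinuousLinearMap.comp_apply, smul_apply,
      hC.apply_bergmanPow hr0 s hs, map_smul] at h1
    -- By `h1`, `C` multiplies this vector by `μ * r ^ s`; if the vector is nonzero, the norm bound
    -- forces `‖μ‖ * r ^ s.re ≤ r⁻¹`, against `hs2`.
    have h2 := hC.norm_apply_le hr0 hr1 (X (bergmanPow s hs))
    rw [h1, norm_smul, norm_smul, Complex.norm_exp, Complex.re_mul_ofReal, mul_comm s.re,
      ← Real.rpow_def_of_pos hr0] at h2
    by_contra hne
    have hpos : 0 < ‖X (bergmanPow s hs)‖ := norm_pos_iff.2 hne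
    rw [← mul_assoc] at h2
    have h3 := le_of_mul_le_mul_right h2 hpos
    rw [Real.rpow_add_one hr0.ne', ← mul_assoc] at hs2
    have h4 := mul_le_mul_of_nonneg_right h3 hr0.le
    rw [inv_mul_cancel₀ hr0.ne'] at h4
    linarith

theorem theorem4p13 (r : ℝ) (hr0 : 0 < r) (hr1 : r < 1) :
    (∃ C : bergmanSpace →L[ℂ] bergmanSpace,
      IsCompositionOperator (fun z : ℂ => (r : ℂ) * z + 1 - (r : ℂ)) C) ∧
    ∀ C : bergmanSpace →L[ℂ] bergmanSpace,
      IsCompositionOperator (fun z : ℂ => (r : ℂ) * z + 1 - (r : ℂ)) C →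
        extendedSpectrum C = Metric.closedBall (0 : ℂ) 1 \ {0} := by
  refine ⟨exists_isCompositionOperator hr0 hr1, fun C hC => Subset.antisymm ?_ ?_⟩
  · intro μ hμ
    refine ⟨?_, ?_⟩
    · rw [mem_closedBall_zero_iff]
      by_contra! h
      exact not_mem_extendedSpectrum_of_one_lt_norm hr0 hr1 hC h hμ
    · rintro rfl
      obtain ⟨X, hX0, hX⟩ := hμ
      refine hX0 (ContinuousLinearMap.ext fun f => ?_)
      refine hC.eq_zero_of_apply_eq_zero hr0 hr1 ?_
      simpa using congrArg (fun T => T f) hX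
  · rintro μ ⟨h1, h0⟩
    rw [mem_closedBall_zero_iff] at h1
    rw [mem_singleton_iff] at h0
    have hlog : Real.log r < 0 := Real.log_neg hr0 hr1
    have hlog' : ((Real.log r : ℝ) : ℂ) ≠ 0 := by exact_mod_cast hlog.ne
    -- The real part is `log ‖μ‖ / log r`, a quotient of nonpositive numbers.
    have hs : 0 ≤ (Complex.log μ / (Real.log r : ℝ)).re := by
      rw [Complex.div_ofReal_re, Complex.log_re]
      exact div_nonneg_of_nonpos (Real.log_nonpos (norm_nonneg _) h1) hlog.le
    have := hC.exp_mem_extendedSpectrum hr0 hs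
    rwa [div_mul_cancel₀ _ hlog', Complex.exp_log h0] at this
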